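/- Let $n\ge 0$, $\epsilon\in\mathbb R\setminus\{0\}$, and let $J$ be a real symmetric $n\times n$ matrix (for instance a diagonal one). Identify $\mathrm{so}(n)^*$ with $\mathrm{so}(n)$ by $\langle\xi,\eta\rangle=-\frac12\mathrm{tr}(\xi\eta)$ and $\mathrm{Symm}(n)^*$ with $\mathrm{Symm}(n)$ by $\langle v_1,v_2\rangle=\frac12\mathrm{tr}(v_1v_2)$. For a real symmetric matrix $A$ consider on $SO(n)\times SO(n)$ the discrete Lagrange function $$\mathbb L(g,\hat g)=\Lambda(W,P)=-\frac1\epsilon\,\mathrm{tr}(WJ)+\frac\epsilon2\,\mathrm{tr}(WJP),\qquad W=g^{T}\hat g,\quad P=g^{T}Ag .$$ (1) The discrete Euler–Lagrange equations of $\mathbb L$ are equivalent to the system $$(\ast)\qquad\begin{aligned} M_k&=\tfrac1\epsilon(W_kJ-JW_k^{T})-\tfrac\epsilon2(P_kW_kJ-JW_k^{T}P_k),\\ M_{k+1}&=\tfrac1\epsilon(JW_k-W_k^{T}J)-\tfrac\epsilon2(JP_kW_k-W_k^{T}P_kJ),\\ P_{k+1}&=W_k^{T}P_kW_k .\end{aligned}$$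 That is, for all integers $k_0<k_1$: every sequence $(g_k)_{k_0\le k\le k_1}$ in $SO(n)$ has momenta $M_k=L_{g_k}^*\Pi_k\in\mathrm{so}(n)$, where $\Pi_k=\nabla_2\mathbb L(g_{k-1},g_k)$ for $k_0<k\le k_1$ and $\Pi_{k_0}=-\nabla_1\mathbb L(g_{k_0},g_{k_0+1})$; for sequences $(g_k)$ in $SO(n)$ and $(M_k)$ in $\mathrm{so}(n)$, the equations $\nabla_1\mathbb L(g_k,g_{k+1})+\nabla_2\mathbb L(g_{k-1},g_k)=0$ hold for $k_0<k<k_1$ and the $M_k$ are the momenta of $(g_k)$ if and only if $(M_k)$, $P_k=g_k^{T}Ag_k$ and $W_k=g_k^{T}g_{k+1}$ satisfy $(\ast)$ for $k_0\le k<k_1$; and every solution $(M_k,P_k,W_k)$ of $(\ast)$ for $k_0\le k<k_1$ (with $M_k\in\mathrm{so}(n)$, $P_k\in\mathrm{Symm}(n)$, $W_k\in SO(n)$) with $P_{k_0}=g^{T}Ag$ for some $g\in SO(n)$ arises in this way from a solution $(g_k)$ of the discrete Euler–Lagrange equations with $g_{k_0}=g$. (2) The multivalued map (correspondence) $(M_k,P_k)\mapsto(M_{k+1},P_{k+1})$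 on $\mathrm{so}(n)\times\mathrm{Symm}(n)$ described by $(\ast)$ is Poisson with respect to the Lie–Poisson bracket $$\{F,G\}(x)=\langle x,[\nabla F(x),\nabla G(x)]\rangle$$ of the semidirect product Lie algebra $\mathrm{so}(n)\ltimes\mathrm{Symm}(n)$, $[(\xi_1,y_1),(\xi_2,y_2)]=([\xi_1,\xi_2],[\xi_1,y_2]-[\xi_2,y_1])$, whose dual is identified with $\mathrm{so}(n)\times\mathrm{Symm}(n)$ by the pairings above. That is: (a) it is a Poisson relation: with $\sigma(W,P)=(M_k,P_k)$ and $\tau(W,P)=(M_{k+1},P_{k+1})$ given by $(\ast)$ for $W_k=W$, $P_k=P$, whenever $F,F',G,G'$ are smooth functions such that $F'\circ\tau-F\circ\sigma$ and $G'\circ\tau-G\circ\sigma$ have zero differential at $(W,P)\in SO(n)\times\mathrm{Symm}(n)$, then $\{F',G'\}(\tau(W,P))=\{F,G\}(\sigma(W,P))$; (b) every local branch is a Poisson map: if $U\subset\mathrm{so}(n)\times\mathrm{Symm}(n)$ is open, $W:U\to SO(n)$ is differentiable, and $(M,P)$, $\Psi(M,P)$, $W(M,P)$ satisfy $(\ast)$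 in place of $(M_k,P_k)$, $(M_{k+1},P_{k+1})$, $W_k$ for all $(M,P)\in U$, then $\Psi$ is differentiable and $\{F\circ\Psi,G\circ\Psi\}=\{F,G\}\circ\Psi$ on $U$ for all smooth $F,G$. -/

import Mathlib

open Matrix Set
open scoped ContDiff

namespace DiscreteTop

/-- The group `SO(n)`. -/
abbrev SOn (n : ℕ) : Submonoid (Matrix (Fin n) (Fin n) ℝ) :=
  Matrix.specialOrthogonalGroup (Fin n) ℝ

/-- The Lie algebra `so(n)` of skew-symmetric matrices. -/
abbrev son (n : ℕ) :=
  LieAlgebra.Orthogonal.so (Fin n) ℝ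

/-- The space `Symm(n)` of symmetric matrices. -/
def Symm (n : ℕ) : Submodule ℝ (Matrix (Fin n) (Fin n) ℝ) where
  carrier := {P | Pᵀ = P}
  add_mem' := by
    intro a b ha hb
    simp only [mem_ofPred_eq] at ha hb ⊢
    rw [transpose_add, ha, hb]
  zero_mem' := by simp
  smul_mem' := by
    intro c a ha
    simp only [mem_ofPred_eq] at ha ⊢
    rw [transpose_smul, ha]

theorem mem_son {n : ℕ} {A : Matrix (Fin n) (Fin n) ℝ} : A ∈ son n ↔ Aᵀ = -A :=
  LieAlgebra.Orthogonal.mem_so (Fin n) ℝ A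

theorem mem_Symm {n : ℕ} {A : Matrix (Fin n) (Fin n) ℝ} : A ∈ Symm n ↔ Aᵀ = A := Iff.rfl

theorem transpose_son {n : ℕ} (M : son n) : (M.1)ᵀ = -M.1 := mem_son.1 M.2

theorem transpose_Symm {n : ℕ} (P : Symm n) : (P.1)ᵀ = P.1 := P.2

/-- The matrix exponential `so(n) → SO(n)`. -/
noncomputable def expSO {n : ℕ} (ξ : son n) : SOn n :=
  ⟨NormedSpace.exp ξ.1, by
    have key : ∀ η : son n, NormedSpace.exp η.1 * (NormedSpace.exp η.1)ᵀ = 1 := by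
      intro η
      rw [← Matrix.exp_transpose, transpose_son, Matrix.exp_neg]
      exact Matrix.mul_nonsing_inv _ ((Matrix.isUnit_iff_isUnit_det _).1 (Matrix.isUnit_exp _))
    rw [mem_specialOrthogonalGroup_iff, mem_orthogonalGroup_iff]
    refine ⟨key ξ, ?_⟩
    have h2 : ξ.1 = ((1 / 2 : ℝ) • ξ).1 + ((1 / 2 : ℝ) • ξ).1 := by
      have : ξ = (1 / 2 : ℝ) • ξ + (1 / 2 : ℝ) • ξ := by
        rw [← add_smul]; norm_num
      exact congrArg Subtype.val this
    have h3 := congrArg Matrix.det (key ((1 / 2 : ℝ) • ξ))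
    rw [det_mul, det_transpose, det_one] at h3
    rw [h2, Matrix.exp_add_of_commute _ _ (Commute.refl _), det_mul, h3]⟩

/-- The representation `Φ(g) v = g v gᵀ` of `SO(n)` in `Symm(n)`. -/
def Φ {n : ℕ} (g : SOn n) (v : Symm n) : Symm n :=
  ⟨g.1 * v.1 * (g.1)ᵀ, by
    rw [mem_Symm]
    simp only [transpose_mul, transpose_transpose, transpose_Symm, Matrix.mul_assoc]⟩

/-- The pairing `⟨M, ξ⟩ = -½ tr(Mξ)` of `so(n)* ≅ so(n)` with `so(n)`. -/
noncomputable def soPairing {n : ℕ} (M ξ : son n) : ℝ := -(1 / 2) * trace (M.1 * ξ.1)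

/-- The pairing `⟨P, y⟩ = ½ tr(Py)` of `Symm(n)* ≅ Symm(n)` with `Symm(n)`. -/
noncomputable def symmPairing {n : ℕ} (P y : Symm n) : ℝ := (1 / 2) * trace (P.1 * y.1)

/-! ### Discrete Lagrangian mechanics on `SO(n)` -/

/-- `f` has at `g` the right Lie derivative `μ = d'f(g) ∈ so(n)* ≅ so(n)`, that is,
`⟨μ, η⟩ = d/ds f(g e^{sη})` at `s = 0` for all `η`. In the left trivialization of the cotangent
bundle (`Π ∈ T*_g SO(n)` corresponds to `L_g^* Π`), `μ` is the gradient of `f` at `g`. -/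
def HasRightLieDeriv {n : ℕ} (f : SOn n → ℝ) (g : SOn n) (μ : son n) : Prop :=
  ∀ η : son n, HasDerivAt (fun s : ℝ => f (g * expSO (s • η))) (soPairing μ η) 0

/-- The discrete Euler-Lagrange equation `∇₁L(g, g₊) + ∇₂L(g₋, g) = 0` in `T*_g SO(n)`, read in the
left trivialization. -/
def DiscreteEL {n : ℕ} (L : SOn n → SOn n → ℝ) (gm g gp : SOn n) : Prop :=
  ∃ μ₁ μ₂ : son n, HasRightLieDeriv (fun h => L h gp) g μ₁ ∧
    HasRightLieDeriv (fun h => L gm h) g μ₂ ∧ μ₁ + μ₂ = 0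

/-- `M` is the sequence of left-trivialized momenta `M_k = L_{g_k}^* Π_k`, `k₀ ≤ k ≤ k₁`, of the
sequence `g`: `Π_k = ∇₂L(g_{k-1}, g_k)` for `k₀ < k ≤ k₁`, and `Π_{k₀} = -∇₁L(g_{k₀}, g_{k₀+1})` at
the initial point. -/
def IsMomentumSeq {n : ℕ} (L : SOn n → SOn n → ℝ) (k₀ k₁ : ℤ) (g : ℤ → SOn n) (M : ℤ → son n) :
    Prop :=
  HasRightLieDeriv (fun h => L h (g (k₀ + 1))) (g k₀) (-(M k₀)) ∧
    ∀ k ∈ Ioc k₀ k₁, HasRightLieDeriv (fun h => L (g (k - 1)) h) (g k) (M k)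

/-- The reduced Lagrange function `Λ(W, P) = -(1/ε) tr(WJ) + (ε/2) tr(WJP)`. -/
noncomputable def reducedLagr {n : ℕ} (ε : ℝ) (J : Symm n) (W : SOn n) (P : Symm n) : ℝ :=
  -(1 / ε) * trace (W.1 * J.1) + (ε / 2) * trace (W.1 * J.1 * P.1)

/-- The Lagrange function on `SO(n) × SO(n)`: `L(g, h) = Λ(W, P)` with `W = g⁻¹h` and
`P = Φ(g⁻¹) A = gᵀ A g`. -/
noncomputable def lagr {n : ℕ} (ε : ℝ) (J A : Symm n) (g h : SOn n) : ℝ :=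
  reducedLagr ε J (g⁻¹ * h) (Φ g⁻¹ A)

/-! ### The explicit system -/

/-- `M_k = (1/ε)(W J - J Wᵀ) - (ε/2)(P W J - J Wᵀ P)`. -/
noncomputable def momBefore {n : ℕ} (ε : ℝ) (J : Symm n) (W : SOn n) (P : Symm n) : son n :=
  ⟨(1 / ε) • (W.1 * J.1 - J.1 * (W.1)ᵀ) - (ε / 2) • (P.1 * W.1 * J.1 - J.1 * (W.1)ᵀ * P.1), by
    rw [mem_son]
    simp only [transpose_sub, transpose_smul, transpose_mul, transpose_transpose, transpose_Symm,
      Matrix.mul_assoc, neg_sub]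
    module⟩

/-- `M_{k+1} = (1/ε)(J W - Wᵀ J) - (ε/2)(J P W - Wᵀ P J)`. -/
noncomputable def momAfter {n : ℕ} (ε : ℝ) (J : Symm n) (W : SOn n) (P : Symm n) : son n :=
  ⟨(1 / ε) • (J.1 * W.1 - (W.1)ᵀ * J.1) - (ε / 2) • (J.1 * P.1 * W.1 - (W.1)ᵀ * P.1 * J.1), by
    rw [mem_son]
    simp only [transpose_sub, transpose_smul, transpose_mul, transpose_transpose, transpose_Symm,
      Matrix.mul_assoc, neg_sub]
    module⟩

/-- The phase space `(so(n) ⋉ Symm(n))* ≅ so(n) × Symm(n)`, with points `(M, P)`. -/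
abbrev Phase (n : ℕ) : Type := son n × Symm n

/-- The pair `(M_k, P_k)` determined by `W_k = W` and `P_k = P`. -/
noncomputable def source {n : ℕ} (ε : ℝ) (J : Symm n) (W : SOn n) (P : Symm n) : Phase n :=
  (momBefore ε J W P, P)

/-- The pair `(M_{k+1}, P_{k+1})` determined by `W_k = W` and `P_k = P`; here
`P_{k+1} = Φ(W⁻¹) P = Wᵀ P W`. -/
noncomputable def target {n : ℕ} (ε : ℝ) (J : Symm n) (W : SOn n) (P : Symm n) : Phase n :=
  (momAfter ε J W P, Φ W⁻¹ P)

/-- The three equations of the explicit system, for `x = (M_k, P_k)`, `x' = (M_{k+1}, P_{k+1})` and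
`W = W_k`. -/
def IsStep {n : ℕ} (ε : ℝ) (J : Symm n) (W : SOn n) (x x' : Phase n) : Prop :=
  x.1 = momBefore ε J W x.2 ∧ x'.1 = momAfter ε J W x.2 ∧ x'.2 = Φ W⁻¹ x.2

/-! ### The semidirect product Lie algebra and its Lie-Poisson bracket -/

/-- The additive group `Symm(n)` as an abelian Lie algebra. -/
instance symmLieRing (n : ℕ) : LieRing (Symm n) where
  bracket _ _ := 0
  add_lie _ _ _ := by simp
  lie_add _ _ _ := by simp
  lie_self _ := rfl
  leibniz_lie _ _ _ := by simp

instance symmLieAlgebra (n : ℕ) : LieAlgebra ℝ (Symm n) where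
  lie_smul c _ _ := (smul_zero c).symm

/-- The representation `-φ^*` of `so(n)` in `Symm(n)`: `ξ` acts by `y ↦ [ξ, y] = ξy - yξ`. -/
def commRep (n : ℕ) : son n →ₗ⁅ℝ⁆ LieDerivation ℝ (Symm n) (Symm n) where
  toFun ξ :=
    { toFun := fun y => ⟨ξ.1 * y.1 - y.1 * ξ.1, by
        rw [mem_Symm]
        simp only [transpose_sub, transpose_mul, transpose_Symm, transpose_son]
        noncomm_ring⟩
      map_add' := fun a b => Subtype.ext (by simp; noncomm_ring)
      map_smul' := fun c a => Subtype.ext (by simp [smul_sub])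
      leibniz' := fun a b => by
        apply Subtype.ext
        simp [Bracket.bracket] }
  map_add' ξ η := by
    ext1 y
    apply Subtype.ext
    simp [add_mul, mul_add]
    noncomm_ring
  map_smul' c ξ := by
    ext1 y
    apply Subtype.ext
    simp [smul_sub]
  map_lie' := by
    intro ξ η
    ext1 y
    apply Subtype.ext
    simp [Ring.lie_def]
    noncomm_ring

/-- The semidirect product Lie algebra `so(n) ⋉ Symm(n)`, with the bracket
`[(ξ₁, y₁), (ξ₂, y₂)] = ([ξ₁, ξ₂], [ξ₁, y₂] - [ξ₂, y₁])`. -/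
abbrev SemiProd (n : ℕ) : Type := LieAlgebra.SemiDirectSum (Symm n) (son n) (commRep n)

/-- The pairing `⟨(M, P), (ξ, y)⟩ = ⟨M, ξ⟩ + ⟨P, y⟩` that identifies `so(n) × Symm(n)` with the dual
of `so(n) ⋉ Symm(n)`. -/
noncomputable def pairing {n : ℕ} (x : Phase n) (X : SemiProd n) : ℝ :=
  soPairing x.1 X.right + symmPairing x.2 X.left

/-- The pairing as a linear map from the Lie algebra to the dual of the phase space. -/
noncomputable def pairingLin (n : ℕ) : SemiProd n →ₗ[ℝ] Module.Dual ℝ (Phase n) :=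
  LinearMap.mk₂ ℝ (fun X x => pairing x X)
    (fun X Y x => by simp [pairing, soPairing, symmPairing, mul_add]; ring)
    (fun c X x => by simp [pairing, soPairing, symmPairing]; ring)
    (fun X x y => by simp [pairing, soPairing, symmPairing, add_mul]; ring)
    (fun c X x => by simp [pairing, soPairing, symmPairing]; ring)

theorem pairingLin_injective (n : ℕ) : Function.Injective (pairingLin n) := by
  rw [injective_iff_map_eq_zero]
  intro X hX
  have hz : ∀ A : Matrix (Fin n) (Fin n) ℝ, trace (Aᵀ * A) = 0 → A = 0 := by
    intro A h
    rw [← conjTranspose_eq_transpose_of_trivial] at h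
    exact trace_conjTranspose_mul_self_eq_zero_iff.1 h
  have h1 : pairing (X.right, 0) X = 0 := LinearMap.congr_fun hX (X.right, 0)
  have h2 : pairing (0, X.left) X = 0 := LinearMap.congr_fun hX (0, X.left)
  have e1 : X.right = 0 := by
    apply Subtype.ext
    apply hz
    simp [pairing, soPairing, symmPairing] at h1
    rw [transpose_son, neg_mul, trace_neg, h1, neg_zero]
  have e2 : X.left = 0 := by
    apply Subtype.ext
    apply hz
    simp [pairing, soPairing, symmPairing] at h2
    rw [transpose_Symm, h2]
  exact LieAlgebra.SemiDirectSum.ext e2 e1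

theorem finrank_semiProd (n : ℕ) :
    Module.finrank ℝ (SemiProd n) = Module.finrank ℝ (Module.Dual ℝ (Phase n)) := by
  rw [Subspace.dual_finrank_eq, (LieAlgebra.SemiDirectSum.toProdl (commRep n)).finrank_eq,
    Module.finrank_prod, Module.finrank_prod, add_comm]

/-- The identification of `so(n) ⋉ Symm(n)` with the dual of the phase space by the pairing. -/
noncomputable def pairingEquiv (n : ℕ) : SemiProd n ≃ₗ[ℝ] Module.Dual ℝ (Phase n) :=
  haveI : FiniteDimensional ℝ (SemiProd n) :=
    Module.Finite.equiv ((LinearEquiv.prodComm ℝ (son n) (Symm n)).trans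
      (LieAlgebra.SemiDirectSum.toProdl (commRep n)).symm)
  LinearEquiv.ofInjectiveOfFinrankEq (pairingLin n) (pairingLin_injective n) (finrank_semiProd n)

end DiscreteTop

-- A norm on matrices, needed only to speak of derivatives.
attribute [local instance] Matrix.normedAddCommGroup Matrix.normedSpace

namespace DiscreteTop

/-- The gradient `∇F(x) = (∇_M F, ∇_P F) ∈ so(n) ⋉ Symm(n)`, the element `X` with
`⟨v, X⟩ = DF(x) v` for all `v`. -/
noncomputable def gradient {n : ℕ} (F : Phase n → ℝ) (x : Phase n) : SemiProd n :=
  (pairingEquiv n).symm (fderiv ℝ F x).toLinearMap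

theorem pairing_gradient {n : ℕ} (F : Phase n → ℝ) (x v : Phase n) :
    pairing v (gradient F x) = fderiv ℝ F x v :=
  LinearMap.congr_fun ((pairingEquiv n).apply_symm_apply (fderiv ℝ F x).toLinearMap) v

/-- The Lie-Poisson bracket `{F, G}(x) = ⟨x, [∇F(x), ∇G(x)]⟩` of `so(n) ⋉ Symm(n)`. -/
noncomputable def poissonBracket {n : ℕ} (F G : Phase n → ℝ) (x : Phase n) : ℝ :=
  pairing x ⁅gradient F x, gradient G x⁆

/-- `Ψ` is a (differentiable) Poisson map on the open set `U`. -/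
def IsPoissonMapOn {n : ℕ} (Ψ : Phase n → Phase n) (U : Set (Phase n)) : Prop :=
  DifferentiableOn ℝ Ψ U ∧
    ∀ F G : Phase n → ℝ, ContDiff ℝ ∞ F → ContDiff ℝ ∞ G → ∀ x ∈ U,
      poissonBracket (F ∘ Ψ) (G ∘ Ψ) x = poissonBracket F G (Ψ x)

/-- The differential at `(W, P)` of the function `f` on `SO(n) × Symm(n)` vanishes. -/
def HasZeroDifferential {n : ℕ} (f : SOn n → Symm n → ℝ) (W : SOn n) (P : Symm n) : Prop :=
  ∀ (η : son n) (Q : Symm n), HasDerivAt (fun s : ℝ => f (W * expSO (s • η)) (P + s • Q)) 0 0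

/-- The correspondence `{(σ(W, P), τ(W, P))}` in the phase space is a Poisson relation: its
conormal spaces are isotropic for the difference of the Poisson structures of target and source.
Conormal vectors at `(W, P)` are given by pairs `(F, F')` of functions such that
`F' ∘ τ - F ∘ σ` has zero differential at `(W, P)`. -/
def IsPoissonCorrespondence {n : ℕ} (σ τ : SOn n → Symm n → Phase n) : Prop :=
  ∀ (W : SOn n) (P : Symm n) (F F' G G' : Phase n → ℝ),
    ContDiff ℝ ∞ F → ContDiff ℝ ∞ F' → ContDiff ℝ ∞ G → ContDiff ℝ ∞ G' →
    HasZeroDifferential (fun w p => F' (τ w p) - F (σ w p)) W P →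
    HasZeroDifferential (fun w p => G' (τ w p) - G (σ w p)) W P →
    poissonBracket F' G' (τ W P) = poissonBracket F G (σ W P)

end DiscreteTop

open DiscreteTop

/-!
**Euler–Lagrange equations.** Differentiating `lagr` along `s ↦ g e^{sη}` in either argument gives
the right Lie derivatives `-momBefore` (first argument) and `momAfter` (second argument)
(`hasRightLieDeriv_lagr_left`, `hasRightLieDeriv_lagr_right`); they are unique because the trace
form is definite on skew-symmetric matrices. Hence the discrete Euler–Lagrange equation at `k` says
that the two expressions for `M_k` coming from the steps `k - 1 → k` and `k → k + 1` agree, which is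
the content of the first two equations of the system. The third equation is the identity
`Φ (g h)⁻¹ = Φ h⁻¹ ∘ Φ g⁻¹`. Conversely a sequence `W` is integrated to `g_{k+1} = g_k W_k`.

**Poisson property.** Write `dσ`, `dτ` (`dSource`, `dTarget`) for the differentials at `(W, P)` of
source and target, in the left trivialization of `SO(n)`. Both Poisson statements reduce to linear
algebra: if `⟨dτ u, X'⟩ = ⟨dσ u, X⟩` and `⟨dτ u, Y'⟩ = ⟨dσ u, Y⟩` for every tangent vector `u`, then
`⟨τ, [X', Y']⟩ = ⟨σ, [X, Y]⟩` (`pairing_target_lie_eq_source`). Both sides equal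
`B(ξ, ζ') - B(ζ, ξ')` with `B(ξ, ζ') = (1/ε) tr(JξWζ') - (ε/2) tr(JξPWζ')`, where `ξ, ξ', ζ, ζ'` are
the `so(n)`-components of `X, X', Y, Y'`. The left side is brought to this form by
`u = (ζ', 0), (ξ', 0)`; the right side by the tangent vectors `u = (WᵀξW, [ξ, P])` (and the same
with `ζ`) of the action `(W, P) ↦ (hW, hPhᵀ)`, along which `WᵀPW` is constant.

For the correspondence, the hypothesis on `X = ∇F`, `X' = ∇F'` is the vanishing of the differential
of `F' ∘ τ - F ∘ σ`. For a branch `Ψ`, the map `x ↦ (W(x), P)` is a section of `σ` with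
`τ ∘ section = Ψ`; so `dσ` is surjective, hence bijective by equality of dimensions, and
`dτ = dΨ ∘ dσ` (`dTarget_eq_fderiv`), which gives the hypothesis for `X = ∇(F ∘ Ψ)`, `X' = ∇F`.
-/

namespace DiscreteTop

variable {n : ℕ}

/-! ### Group elements -/

theorem coe_inv_SOn (g : SOn n) : (g⁻¹).1 = (g.1)ᵀ := rfl

theorem transpose_mul_self_SOn (g : SOn n) : (g.1)ᵀ * g.1 = 1 :=
  congrArg Subtype.val (inv_mul_cancel g)

theorem self_mul_transpose_SOn (g : SOn n) : g.1 * (g.1)ᵀ = 1 :=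
  congrArg Subtype.val (mul_inv_cancel g)

theorem Φ_mul_inv (g h : SOn n) (v : Symm n) : Φ (g * h)⁻¹ v = Φ h⁻¹ (Φ g⁻¹ v) := by
  apply Subtype.ext
  simp [Φ, coe_inv_SOn, Matrix.mul_assoc]

theorem coe_expSO_zero : (expSO (0 : son n)).1 = 1 := by
  simp [expSO]

theorem Φ_inv_val (g : SOn n) (v : Symm n) : (Φ g⁻¹ v).1 = (g.1)ᵀ * v.1 * g.1 := by
  simp [Φ, coe_inv_SOn]

/-! ### Skew-symmetric and symmetric parts, and the trace pairings -/

/-- The linear map `A ↦ A - Aᵀ` onto skew-symmetric matrices. -/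
def skew : Matrix (Fin n) (Fin n) ℝ →ₗ[ℝ] son n where
  toFun A := ⟨A - Aᵀ, by rw [mem_son]; simp⟩
  map_add' A B := Subtype.ext (by simp; abel)
  map_smul' c A := Subtype.ext (by simp [smul_sub])

/-- The linear map `A ↦ (A + Aᵀ) / 2` onto symmetric matrices. -/
noncomputable def sym : Matrix (Fin n) (Fin n) ℝ →ₗ[ℝ] Symm n where
  toFun A := ⟨(1 / 2 : ℝ) • (A + Aᵀ), by rw [mem_Symm]; simp [add_comm]⟩
  map_add' A B := Subtype.ext (by simp; abel)
  map_smul' c A := Subtype.ext (by simp [smul_add, smul_comm c])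

@[simp] theorem skew_val (A : Matrix (Fin n) (Fin n) ℝ) : (skew A).1 = A - Aᵀ := rfl

@[simp] theorem sym_val (A : Matrix (Fin n) (Fin n) ℝ) :
    (sym A).1 = (1 / 2 : ℝ) • (A + Aᵀ) := rfl

theorem sym_coe (P : Symm n) : sym P.1 = P := by
  apply Subtype.ext
  rw [sym_val, transpose_Symm]
  module

theorem soPairing_skew (A : Matrix (Fin n) (Fin n) ℝ) (ξ : son n) :
    soPairing (skew A) ξ = -trace (A * ξ.1) := by
  have h : trace (Aᵀ * ξ.1) = -trace (A * ξ.1) := by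
    rw [← trace_transpose, transpose_mul, transpose_transpose, transpose_son, neg_mul, trace_neg,
      trace_mul_comm]
  rw [soPairing, skew_val, sub_mul, trace_sub, h]
  ring

theorem symmPairing_sym (A : Matrix (Fin n) (Fin n) ℝ) (y : Symm n) :
    symmPairing (sym A) y = (1 / 2) * trace (A * y.1) := by
  have h : trace (Aᵀ * y.1) = trace (A * y.1) := by
    rw [← trace_transpose, transpose_mul, transpose_transpose, transpose_Symm, trace_mul_comm]
  rw [symmPairing, sym_val, smul_mul_assoc, trace_smul, add_mul, trace_add, h, smul_eq_mul]
  ring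

theorem momBefore_eq_skew (ε : ℝ) (J : Symm n) (W : SOn n) (P : Symm n) :
    momBefore ε J W P = skew ((1 / ε) • (W.1 * J.1) - (ε / 2) • (P.1 * W.1 * J.1)) := by
  apply Subtype.ext
  simp only [momBefore, skew_val, transpose_sub, transpose_smul, transpose_mul, transpose_Symm,
    Matrix.mul_assoc]
  module

theorem momAfter_eq_skew (ε : ℝ) (J : Symm n) (W : SOn n) (P : Symm n) :
    momAfter ε J W P = skew ((1 / ε) • (J.1 * W.1) - (ε / 2) • (J.1 * P.1 * W.1)) := by
  apply Subtype.ext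
  simp only [momAfter, skew_val, transpose_sub, transpose_smul, transpose_mul, transpose_Symm,
    Matrix.mul_assoc]
  module

theorem Φ_inv_eq_sym (W : SOn n) (P : Symm n) : Φ W⁻¹ P = sym ((W.1)ᵀ * P.1 * W.1) := by
  rw [← Φ_inv_val, sym_coe]

theorem soPairing_sub_left (μ ν ξ : son n) :
    soPairing (μ - ν) ξ = soPairing μ ξ - soPairing ν ξ := by
  simp [soPairing, sub_mul]; ring

theorem eq_zero_of_soPairing_self {μ : son n} (h : soPairing μ μ = 0) : μ = 0 := by
  apply Subtype.ext
  have h1 : trace ((μ.1)ᴴ * μ.1) = 0 := by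
    rw [conjTranspose_eq_transpose_of_trivial, transpose_son, neg_mul, trace_neg]
    simp only [soPairing] at h
    linarith
  exact trace_conjTranspose_mul_self_eq_zero_iff.1 h1

/-! ### Calculus of matrix-valued functions -/

-- Matrices with the entrywise norm are not a normed ring. Differentiability depends only on the
-- topology, which is that of the submultiplicative operator norm, where the product rule holds.
theorem differentiableAt_matrix_mul {E : Type*} [NormedAddCommGroup E] [NormedSpace ℝ E]
    {f g : E → Matrix (Fin n) (Fin n) ℝ} {x : E} (hf : DifferentiableAt ℝ f x)
    (hg : DifferentiableAt ℝ g x) : DifferentiableAt ℝ (fun y => f y * g y) x :=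
  open scoped Matrix.Norms.Operator in DifferentiableAt.mul hf hg

theorem hasDerivAt_matrix_mul {f g : ℝ → Matrix (Fin n) (Fin n) ℝ}
    {f' g' : Matrix (Fin n) (Fin n) ℝ} {x : ℝ} (hf : HasDerivAt f f' x) (hg : HasDerivAt g g' x) :
    HasDerivAt (fun s => f s * g s) (f' * g x + f x * g') x :=
  open scoped Matrix.Norms.Operator in HasDerivAt.mul hf hg

theorem hasDerivAt_linearMap {E F : Type*} [NormedAddCommGroup E] [NormedSpace ℝ E]
    [FiniteDimensional ℝ E] [NormedAddCommGroup F] [NormedSpace ℝ F] (l : E →ₗ[ℝ] F)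
    {f : ℝ → E} {f' : E} {x : ℝ} (hf : HasDerivAt f f' x) :
    HasDerivAt (fun s => l (f s)) (l f') x :=
  l.toContinuousLinearMap.hasFDerivAt.comp_hasDerivAt x hf

theorem differentiableAt_linearMap {E F G : Type*} [NormedAddCommGroup E] [NormedSpace ℝ E]
    [FiniteDimensional ℝ E] [NormedAddCommGroup F] [NormedSpace ℝ F]
    [NormedAddCommGroup G] [NormedSpace ℝ G] (l : E →ₗ[ℝ] F)
    {f : G → E} {x : G} (hf : DifferentiableAt ℝ f x) :
    DifferentiableAt ℝ (fun s => l (f s)) x :=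
  l.toContinuousLinearMap.differentiableAt.comp x hf

theorem hasDerivAt_expSO (η : son n) : HasDerivAt (fun s : ℝ => (expSO (s • η)).1) η.1 0 := by
  have h : HasDerivAt (fun s : ℝ => NormedSpace.exp (s • η.1))
      (NormedSpace.exp ((0 : ℝ) • η.1) * η.1) 0 :=
    open scoped Matrix.Norms.Operator in hasDerivAt_exp_smul_const (𝕂 := ℝ) η.1 (0 : ℝ)
  rw [zero_smul, NormedSpace.exp_zero, one_mul] at h
  exact h

theorem hasDerivAt_matrix_transpose {f : ℝ → Matrix (Fin n) (Fin n) ℝ}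
    {f' : Matrix (Fin n) (Fin n) ℝ} {x : ℝ} (hf : HasDerivAt f f' x) :
    HasDerivAt (fun s => (f s)ᵀ) (f')ᵀ x :=
  hasDerivAt_linearMap (transposeLinearEquiv (Fin n) (Fin n) ℝ ℝ).toLinearMap hf

theorem hasDerivAt_matrix_trace {f : ℝ → Matrix (Fin n) (Fin n) ℝ}
    {f' : Matrix (Fin n) (Fin n) ℝ} {x : ℝ} (hf : HasDerivAt f f' x) :
    HasDerivAt (fun s => trace (f s)) (trace f') x :=
  hasDerivAt_linearMap (traceLinearMap (Fin n) ℝ ℝ) hf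

/-! ### The differentials of source and target -/

/-- The differential of `source` at `(W, P)`. A tangent vector of `SO(n) × Symm(n)` is encoded as
`u = (η, Q) : Phase n`, which stands for the velocity `(Wη, Q)`. -/
noncomputable def dSource (ε : ℝ) (J : Symm n) (W : SOn n) (P : Symm n) :
    Phase n →ₗ[ℝ] Phase n where
  toFun u := (skew ((1 / ε) • (W.1 * u.1.1 * J.1) -
    (ε / 2) • (P.1 * (W.1 * u.1.1) * J.1 + u.2.1 * W.1 * J.1)), u.2)
  map_add' u v := by
    refine Prod.ext ?_ rfl
    change skew _ = skew _ + skew _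
    rw [← map_add]
    congr 1
    have h₁ : (u + v).1.1 = u.1.1 + v.1.1 := rfl
    have h₂ : (u + v).2.1 = u.2.1 + v.2.1 := rfl
    simp only [h₁, h₂, mul_add, add_mul]
    module
  map_smul' c u := by
    refine Prod.ext ?_ rfl
    change skew _ = c • skew _
    rw [← map_smul]
    congr 1
    have h₁ : (c • u).1.1 = c • u.1.1 := rfl
    have h₂ : (c • u).2.1 = c • u.2.1 := rfl
    simp only [h₁, h₂, Matrix.mul_smul, Matrix.smul_mul]
    module

/-- The differential of `target` at `(W, P)`, with tangent vectors `u = (η, Q)` encoded as in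
`dSource`. The second component is the symmetric part of `WᵀQW + 2 WᵀPWη`, that is
`WᵀQW + WᵀPWη - ηWᵀPW`. -/
noncomputable def dTarget (ε : ℝ) (J : Symm n) (W : SOn n) (P : Symm n) (u : Phase n) : Phase n :=
  (skew ((1 / ε) • (J.1 * (W.1 * u.1.1)) -
    (ε / 2) • (J.1 * P.1 * (W.1 * u.1.1) + J.1 * u.2.1 * W.1)),
   sym ((W.1)ᵀ * u.2.1 * W.1 + (2 : ℝ) • ((W.1)ᵀ * P.1 * (W.1 * u.1.1))))

theorem hasDerivAt_Symm_coe {f : ℝ → Symm n} {f' : Symm n} {x : ℝ} (hf : HasDerivAt f f' x) :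
    HasDerivAt (fun s => (f s).1) f'.1 x :=
  hasDerivAt_linearMap (Symm n).subtype hf

section Curves

variable {w : ℝ → SOn n} {p : ℝ → Symm n} {W : SOn n} {P Q : Symm n} {η : son n}

theorem hasDerivAt_source (ε : ℝ) (J : Symm n)
    (hw : HasDerivAt (fun s => (w s).1) (W.1 * η.1) 0) (hp : HasDerivAt p Q 0)
    (hw0 : w 0 = W) (hp0 : p 0 = P) :
    HasDerivAt (fun s => source ε J (w s) (p s)) (dSource ε J W P (η, Q)) 0 := by
  subst hw0 hp0
  have hp' := hasDerivAt_Symm_coe hp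
  have hJ := hasDerivAt_const (0 : ℝ) J.1
  have h1 := hasDerivAt_matrix_mul hw hJ
  have h2 := hasDerivAt_matrix_mul (hasDerivAt_matrix_mul hp' hw) hJ
  have h3 := hasDerivAt_linearMap skew ((h1.const_smul (1 / ε)).sub (h2.const_smul (ε / 2)))
  refine ((h3.prodMk hp).congr_deriv ?_).congr_of_eventuallyEq
    (.of_forall fun s => Prod.ext (momBefore_eq_skew ..) rfl)
  refine Prod.ext ?_ rfl
  change skew _ = skew _
  congr 1
  simp only [mul_zero, add_zero, add_mul]
  module

theorem hasDerivAt_target (ε : ℝ) (J : Symm n)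
    (hw : HasDerivAt (fun s => (w s).1) (W.1 * η.1) 0) (hp : HasDerivAt p Q 0)
    (hw0 : w 0 = W) (hp0 : p 0 = P) :
    HasDerivAt (fun s => target ε J (w s) (p s)) (dTarget ε J W P (η, Q)) 0 := by
  subst hw0 hp0
  have hp' := hasDerivAt_Symm_coe hp
  have hJ := hasDerivAt_const (0 : ℝ) J.1
  have h1 := hasDerivAt_matrix_mul hJ hw
  have h2 := hasDerivAt_matrix_mul (hasDerivAt_matrix_mul hJ hp') hw
  have h3 := hasDerivAt_linearMap skew ((h1.const_smul (1 / ε)).sub (h2.const_smul (ε / 2)))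
  have h5 := hasDerivAt_linearMap sym (hasDerivAt_matrix_mul
    (hasDerivAt_matrix_mul (hasDerivAt_matrix_transpose hw) hp') hw)
  refine ((h3.prodMk h5).congr_deriv ?_).congr_of_eventuallyEq
    (.of_forall fun s => Prod.ext (momAfter_eq_skew ..) (Φ_inv_eq_sym ..))
  refine Prod.ext ?_ ?_
  · change skew _ = skew _
    congr 1
    simp only [zero_mul, zero_add]
    module
  · apply Subtype.ext
    simp only [dTarget, sym_val, transpose_add, transpose_mul, transpose_transpose, transpose_smul,
      transpose_son, transpose_Symm, transpose_neg, add_mul, Matrix.mul_assoc, smul_add, neg_mul,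
      Matrix.mul_neg, neg_neg]
    module

theorem hasDerivAt_mul_expSO (W : SOn n) (η : son n) :
    HasDerivAt (fun s : ℝ => (W * expSO (s • η)).1) (W.1 * η.1) 0 := by
  have h := hasDerivAt_matrix_mul (hasDerivAt_const (0 : ℝ) W.1) (hasDerivAt_expSO η)
  rw [zero_mul, zero_add] at h
  exact h

theorem mul_expSO_zero (W : SOn n) (η : son n) : W * expSO ((0 : ℝ) • η) = W := by
  apply Subtype.ext
  rw [zero_smul]
  change W.1 * (expSO (0 : son n)).1 = W.1
  rw [coe_expSO_zero, mul_one]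

/-- The velocity `D` of `w` is an arbitrary matrix here: left and right translation present it in
different forms. -/
theorem hasDerivAt_reducedLagr (ε : ℝ) (J : Symm n) {D : Matrix (Fin n) (Fin n) ℝ}
    (hw : HasDerivAt (fun s => (w s).1) D 0) (hp : HasDerivAt p Q 0)
    (hw0 : w 0 = W) (hp0 : p 0 = P) :
    HasDerivAt (fun s => reducedLagr ε J (w s) (p s))
      (-(1 / ε) * trace (D * J.1) +
        (ε / 2) * (trace (D * J.1 * P.1) + trace (W.1 * J.1 * Q.1))) 0 := by
  subst hw0 hp0
  have hp' := hasDerivAt_Symm_coe hp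
  have hJ := hasDerivAt_const (0 : ℝ) J.1
  have h1 := hasDerivAt_matrix_mul hw hJ
  have h2 := hasDerivAt_matrix_mul h1 hp'
  refine (((hasDerivAt_matrix_trace h1).const_mul (-(1 / ε))).add
    ((hasDerivAt_matrix_trace h2).const_mul (ε / 2))).congr_deriv ?_
  simp only [mul_zero, add_zero, trace_add]

end Curves

/-! ### Momenta and the discrete Euler–Lagrange equations -/

theorem hasRightLieDeriv_lagr_right (ε : ℝ) (J A : Symm n) (gm g : SOn n) :
    HasRightLieDeriv (fun h => lagr ε J A gm h) g (momAfter ε J (gm⁻¹ * g) (Φ gm⁻¹ A)) := by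
  intro η
  have h1 := hasDerivAt_mul_expSO (gm⁻¹ * g) η
  have h2 := hasDerivAt_const (0 : ℝ) (Φ gm⁻¹ A)
  have h3 := hasDerivAt_reducedLagr ε J h1 h2 (mul_expSO_zero _ _) rfl
  convert h3 using 1
  · funext s
    simp only [lagr, mul_assoc]
  · generalize Φ gm⁻¹ A = P
    generalize gm⁻¹ * g = W
    rw [momAfter_eq_skew, soPairing_skew]
    simp only [sub_mul, smul_mul_assoc, trace_sub, trace_smul, smul_eq_mul]
    rw [trace_mul_comm (W.1 * η.1) J.1, trace_mul_cycle (W.1 * η.1) J.1 P.1,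
      trace_mul_comm (P.1 * _), ← mul_assoc, ← mul_assoc, ← mul_assoc]
    simp
    ring

theorem hasRightLieDeriv_lagr_left (ε : ℝ) (J A : Symm n) (g gp : SOn n) :
    HasRightLieDeriv (fun h => lagr ε J A h gp) g (-momBefore ε J (g⁻¹ * gp) (Φ g⁻¹ A)) := by
  intro η
  have h0 := hasDerivAt_mul_expSO g η
  have h0' := hasDerivAt_matrix_transpose h0
  have h1 := hasDerivAt_matrix_mul h0' (hasDerivAt_const (0 : ℝ) gp.1)
  have h2 := hasDerivAt_linearMap sym (hasDerivAt_matrix_mul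
    (hasDerivAt_matrix_mul h0' (hasDerivAt_const (0 : ℝ) A.1)) h0)
  have h3 := hasDerivAt_reducedLagr (w := fun s => (g * expSO (s • η))⁻¹ * gp)
    (p := fun s => sym (((g * expSO (s • η)).1)ᵀ * A.1 * (g * expSO (s • η)).1)) ε J h1 h2
    (by simp only [mul_expSO_zero]; rfl) rfl
  convert h3 using 1
  · funext s
    simp only [lagr, Φ_inv_eq_sym]
  · simp only [mul_expSO_zero, Φ_inv_eq_sym]
    have hW : (g.1)ᵀ * gp.1 = (g⁻¹ * gp).1 := rfl
    have hP : (g.1)ᵀ * A.1 * g.1 = (Φ g⁻¹ A).1 := (Φ_inv_val g A).symm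
    have e1 : (g.1 * η.1)ᵀ * gp.1 + ((g.1)ᵀ) * 0 = -(η.1 * (g⁻¹ * gp).1) := by
      rw [transpose_mul, transpose_son, ← hW]; noncomm_ring
    have e2 : ((g.1 * η.1)ᵀ * A.1 + ((g.1)ᵀ) * 0) * g.1 + (g.1)ᵀ * A.1 * (g.1 * η.1) =
        (Φ g⁻¹ A).1 * η.1 - η.1 * (Φ g⁻¹ A).1 := by
      rw [transpose_mul, transpose_son, ← hP]; noncomm_ring
    rw [e1, e2, hP, sym_coe]
    generalize Φ g⁻¹ A = P
    generalize g⁻¹ * gp = W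
    have e3 : (sym (P.1 * η.1 - η.1 * P.1)).1 = P.1 * η.1 - η.1 * P.1 := by
      rw [sym_val]
      simp only [transpose_sub, transpose_mul, transpose_Symm, transpose_son]
      rw [show P.1 * η.1 - η.1 * P.1 + (-η.1 * P.1 - P.1 * -η.1) =
        (2 : ℝ) • (P.1 * η.1 - η.1 * P.1) by rw [two_smul]; noncomm_ring]
      module
    rw [e3, momBefore_eq_skew, ← map_neg, soPairing_skew]
    simp only [neg_mul, trace_neg, sub_mul, mul_sub, smul_mul_assoc, trace_sub, trace_smul,
      smul_eq_mul]
    rw [show trace (η.1 * W.1 * J.1) = trace (W.1 * J.1 * η.1) by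
        rw [mul_assoc, trace_mul_comm],
      show trace (η.1 * W.1 * J.1 * P.1) = trace (W.1 * J.1 * (P.1 * η.1)) by
        rw [mul_assoc, mul_assoc, trace_mul_comm]; simp only [mul_assoc],
      show trace (W.1 * J.1 * (η.1 * P.1)) = trace (P.1 * W.1 * J.1 * η.1) by
        rw [← mul_assoc, trace_mul_comm]; simp only [mul_assoc]]
    ring

theorem HasRightLieDeriv.unique {f : SOn n → ℝ} {g : SOn n} {μ ν : son n}
    (hμ : HasRightLieDeriv f g μ) (hν : HasRightLieDeriv f g ν) : μ = ν := by
  rw [← sub_eq_zero]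
  apply eq_zero_of_soPairing_self
  rw [soPairing_sub_left, (hμ _).unique (hν _), sub_self]

theorem discreteEL_iff (ε : ℝ) (J A : Symm n) (gm g gp : SOn n) :
    DiscreteEL (lagr ε J A) gm g gp ↔
      momAfter ε J (gm⁻¹ * g) (Φ gm⁻¹ A) = momBefore ε J (g⁻¹ * gp) (Φ g⁻¹ A) := by
  have h1 := hasRightLieDeriv_lagr_left ε J A g gp
  have h2 := hasRightLieDeriv_lagr_right ε J A gm g
  constructor
  · rintro ⟨μ₁, μ₂, k1, k2, h⟩
    rw [k1.unique h1, k2.unique h2] at h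
    exact (neg_add_eq_zero.1 h).symm
  · intro h
    exact ⟨_, _, h1, h2, by rw [h, neg_add_cancel]⟩

theorem isMomentumSeq_iff (ε : ℝ) (J A : Symm n) (k₀ k₁ : ℤ) (g : ℤ → SOn n) (M : ℤ → son n) :
    IsMomentumSeq (lagr ε J A) k₀ k₁ g M ↔
      M k₀ = momBefore ε J ((g k₀)⁻¹ * g (k₀ + 1)) (Φ (g k₀)⁻¹ A) ∧
      ∀ k ∈ Ioc k₀ k₁, M k = momAfter ε J ((g (k - 1))⁻¹ * g k) (Φ (g (k - 1))⁻¹ A) := by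
  constructor
  · rintro ⟨h0, h⟩
    exact ⟨neg_injective (h0.unique (hasRightLieDeriv_lagr_left _ _ _ _ _)),
      fun k hk => (h k hk).unique (hasRightLieDeriv_lagr_right _ _ _ _ _)⟩
  · rintro ⟨h0, h⟩
    refine ⟨?_, fun k hk => ?_⟩
    · rw [h0]; exact hasRightLieDeriv_lagr_left _ _ _ _ _
    · rw [h k hk]; exact hasRightLieDeriv_lagr_right _ _ _ _ _

theorem discreteEL_and_momenta_iff_isStep (ε : ℝ) (J A : Symm n) {k₀ k₁ : ℤ} (hk : k₀ < k₁)
    (g : ℤ → SOn n) (M : ℤ → son n) :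
    (IsMomentumSeq (lagr ε J A) k₀ k₁ g M ∧
      ∀ k ∈ Ioo k₀ k₁, DiscreteEL (lagr ε J A) (g (k - 1)) (g k) (g (k + 1))) ↔
    ∀ k ∈ Ico k₀ k₁, IsStep ε J ((g k)⁻¹ * g (k + 1))
      (M k, Φ (g k)⁻¹ A) (M (k + 1), Φ (g (k + 1))⁻¹ A) := by
  simp only [isMomentumSeq_iff, discreteEL_iff, IsStep]
  constructor
  · rintro ⟨⟨h0, h1⟩, h2⟩ k ⟨hk1, hk2⟩
    refine ⟨?_, ?_, ?_⟩
    · rcases hk1.eq_or_lt with rfl | hlt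
      · exact h0
      · rw [h1 k ⟨hlt, hk2.le⟩, h2 k ⟨hlt, hk2⟩]
    · simpa using h1 (k + 1) ⟨by omega, by omega⟩
    · rw [← Φ_mul_inv, mul_inv_cancel_left]
  · intro h
    have h1 : ∀ k ∈ Ioc k₀ k₁,
        M k = momAfter ε J ((g (k - 1))⁻¹ * g k) (Φ (g (k - 1))⁻¹ A) := by
      rintro k ⟨hk1, hk2⟩
      simpa using (h (k - 1) ⟨by omega, by omega⟩).2.1
    refine ⟨⟨(h k₀ ⟨le_rfl, hk⟩).1, h1⟩, fun k hk' => ?_⟩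
    rw [← h1 k ⟨hk'.1, hk'.2.le⟩]
    exact (h k ⟨hk'.1.le, hk'.2⟩).1

theorem exists_momentumSeq (ε : ℝ) (J A : Symm n) (k₀ k₁ : ℤ) (g : ℤ → SOn n) :
    ∃ M : ℤ → son n, IsMomentumSeq (lagr ε J A) k₀ k₁ g M := by
  refine ⟨fun k => if k = k₀ then momBefore ε J ((g k₀)⁻¹ * g (k₀ + 1)) (Φ (g k₀)⁻¹ A)
    else momAfter ε J ((g (k - 1))⁻¹ * g k) (Φ (g (k - 1))⁻¹ A), ?_⟩
  rw [isMomentumSeq_iff]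
  exact ⟨if_pos rfl, fun k hk => if_neg hk.1.ne'⟩

theorem exists_increments (k₀ : ℤ) (g₀ : SOn n) (W : ℤ → SOn n) :
    ∃ g : ℤ → SOn n, g k₀ = g₀ ∧ ∀ k, k₀ ≤ k → g (k + 1) = g k * W k := by
  let G : ℕ → SOn n := fun m => Nat.rec g₀ (fun i h => h * W (k₀ + i)) m
  refine ⟨fun k => G (k - k₀).toNat, by simp [G], fun k hk => ?_⟩
  obtain ⟨m, rfl⟩ := Int.le.dest hk
  have h1 : (k₀ + m + 1 - k₀).toNat = m + 1 := by omega
  have h2 : (k₀ + m - k₀).toNat = m := by omega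
  simp only [h1, h2, G]

theorem exists_solution_of_isStep (ε : ℝ) (J A : Symm n) {k₀ k₁ : ℤ} (hk : k₀ < k₁)
    (M : ℤ → son n) (P : ℤ → Symm n) (W : ℤ → SOn n)
    (h : ∀ k ∈ Ico k₀ k₁, IsStep ε J (W k) (M k, P k) (M (k + 1), P (k + 1)))
    (g₀ : SOn n) (hP : P k₀ = Φ g₀⁻¹ A) :
    ∃ g : ℤ → SOn n, g k₀ = g₀ ∧
      (∀ k ∈ Icc k₀ k₁, P k = Φ (g k)⁻¹ A) ∧
      (∀ k ∈ Ico k₀ k₁, W k = (g k)⁻¹ * g (k + 1)) ∧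
      IsMomentumSeq (lagr ε J A) k₀ k₁ g M ∧
      ∀ k ∈ Ioo k₀ k₁, DiscreteEL (lagr ε J A) (g (k - 1)) (g k) (g (k + 1)) := by
  obtain ⟨g, hg0, hg⟩ := exists_increments k₀ g₀ W
  have hW : ∀ k ∈ Ico k₀ k₁, W k = (g k)⁻¹ * g (k + 1) := fun k hk => by
    rw [hg k hk.1, inv_mul_cancel_left]
  have hPg : ∀ k, k₀ ≤ k → k ≤ k₁ → P k = Φ (g k)⁻¹ A := by
    intro k hk
    induction k, hk using Int.leInduction with
    | base => intro _; rw [hP, hg0]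
    | succ k hk ih =>
      intro hk1
      rw [hg k hk, Φ_mul_inv, ← ih (by omega)]
      exact (h k ⟨hk, by omega⟩).2.2
  refine ⟨g, hg0, fun k hk => hPg k hk.1 hk.2, hW,
    (discreteEL_and_momenta_iff_isStep ε J A hk g M).2 fun k hk => ?_⟩
  rw [← hW k hk, ← hPg k hk.1 hk.2.le, ← hPg (k + 1) (hk.1.trans (by omega)) hk.2]
  exact h k hk

/-! ### Linear algebra of the Poisson property -/

theorem trace_mul_symm_mul_skew (P y : Symm n) (ξ : son n) :
    trace (P.1 * y.1 * ξ.1) = -trace (P.1 * ξ.1 * y.1) := by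
  rw [← trace_transpose]
  simp only [transpose_mul, transpose_Symm, transpose_son, neg_mul, trace_neg]
  rw [← mul_assoc, trace_mul_comm, ← mul_assoc]

theorem pairing_lie (x : Phase n) (X Y : SemiProd n) :
    pairing x ⁅X, Y⁆ = soPairing x.1 ⁅X.right, Y.right⁆ +
      trace (x.2.1 * X.right.1 * Y.left.1) - trace (x.2.1 * Y.right.1 * X.left.1) := by
  have hl : (⁅X, Y⁆ : SemiProd n).left.1 = X.right.1 * Y.left.1 - Y.left.1 * X.right.1 -
      (Y.right.1 * X.left.1 - X.left.1 * Y.right.1) := by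
    change (0 : Matrix (Fin n) (Fin n) ℝ) + _ - _ = _
    rw [zero_add]
    rfl
  have hr : (⁅X, Y⁆ : SemiProd n).right = ⁅X.right, Y.right⁆ := rfl
  rw [pairing, hr, symmPairing, hl]
  simp only [mul_sub, trace_sub, ← mul_assoc, trace_mul_symm_mul_skew]
  ring

theorem pairing_mk (μ : son n) (P : Symm n) (X : SemiProd n) :
    pairing (μ, P) X = soPairing μ X.right + symmPairing P X.left := rfl

/-- If `(X, X')` and `(Y, Y')` are conormal to the correspondence, the bracket at the target is
expressed by the relations along the tangent vectors `(ζ', 0)` and `(ξ', 0)`, where `ξ'`, `ζ'` are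
the `so(n)`-components of `X'`, `Y'`. -/
theorem pairing_target_lie {ε : ℝ} {J : Symm n} {W : SOn n} {P : Symm n} {X X' Y Y' : SemiProd n}
    (hX : ∀ u, pairing (dTarget ε J W P u) X' = pairing (dSource ε J W P u) X)
    (hY : ∀ u, pairing (dTarget ε J W P u) Y' = pairing (dSource ε J W P u) Y) :
    pairing (target ε J W P) ⁅X', Y'⁆ =
      (1 / ε) * trace (J.1 * X.right.1 * W.1 * Y'.right.1) -
        (ε / 2) * trace (J.1 * X.right.1 * P.1 * W.1 * Y'.right.1) -
      ((1 / ε) * trace (J.1 * Y.right.1 * W.1 * X'.right.1) -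
        (ε / 2) * trace (J.1 * Y.right.1 * P.1 * W.1 * X'.right.1)) := by
  have h1 := hX (Y'.right, 0)
  have h2 := hY (X'.right, 0)
  have hlie : (⁅X'.right, Y'.right⁆ : son n).1 =
    X'.right.1 * Y'.right.1 - Y'.right.1 * X'.right.1 := rfl
  have hz : (0 : Symm n).1 = 0 := rfl
  rw [pairing_lie]
  simp only [target, momAfter_eq_skew, Φ_inv_val, dTarget, dSource, LinearMap.coe_mk,
    AddHom.coe_mk, pairing_mk, soPairing_skew, symmPairing_sym, hlie, hz, mul_zero, zero_mul,
    add_zero, zero_add] at h1 h2 ⊢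
  generalize X'.right.1 = ξ' at *
  generalize Y'.right.1 = ζ' at *
  generalize X.right.1 = ξ at *
  generalize Y.right.1 = ζ at *
  have cyc : ∀ A B C D : Matrix (Fin n) (Fin n) ℝ,
      trace (A * (B * (C * D))) = trace (C * (D * (A * B))) := fun A B C D => by
    rw [← mul_assoc, trace_mul_comm, mul_assoc]
  have cyc' : ∀ A B C D E : Matrix (Fin n) (Fin n) ℝ,
      trace (A * (B * (C * (D * E)))) = trace (D * (E * (A * (B * C)))) := fun A B C D E => by
    rw [show A * (B * (C * (D * E))) = (A * B * C) * (D * E) by simp only [mul_assoc],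
      trace_mul_comm]
    simp only [mul_assoc]
  simp only [sub_mul, mul_sub, smul_mul_assoc, trace_sub, trace_smul, smul_eq_mul,
    mul_assoc] at h1 h2 ⊢
  rw [cyc W.1 ζ' J.1 ξ, cyc' P.1 W.1 ζ' J.1 ξ] at h1
  rw [cyc W.1 ξ' J.1 ζ, cyc' P.1 W.1 ξ' J.1 ζ] at h2
  have z : symmPairing (0 : Symm n) X.left = 0 := by simp [symmPairing]
  have z' : symmPairing (0 : Symm n) Y.left = 0 := by simp [symmPairing]
  rw [z] at h1
  rw [z'] at h2
  linear_combination h2 - h1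

/-- The conormal relation for `(Y, Y')` along the tangent vector `(WᵀξW, [ξ, P])`, the velocity of
`(hW, hPhᵀ)` for `h = e^{sξ}`. -/
theorem trace_mul_left_of_conormal {ε : ℝ} {J : Symm n} {W : SOn n} {P : Symm n} {Y Y' : SemiProd n}
    (hY : ∀ u, pairing (dTarget ε J W P u) Y' = pairing (dSource ε J W P u) Y) (ξ : son n) :
    trace (P.1 * ξ.1 * Y.left.1) =
      (1 / ε) * trace (J.1 * ξ.1 * W.1 * Y'.right.1) -
        (ε / 2) * trace (J.1 * ξ.1 * P.1 * W.1 * Y'.right.1) -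
      (1 / ε) * trace (ξ.1 * W.1 * J.1 * Y.right.1) +
        (ε / 2) * trace (ξ.1 * P.1 * W.1 * J.1 * Y.right.1) := by
  let η : son n := ⟨(W.1)ᵀ * ξ.1 * W.1, by
    rw [mem_son]
    simp only [transpose_mul, transpose_transpose, transpose_son, mul_assoc, neg_mul, mul_neg]⟩
  let Q : Symm n := ⟨ξ.1 * P.1 - P.1 * ξ.1, by
    rw [mem_Symm]
    simp only [transpose_sub, transpose_mul, transpose_Symm, transpose_son]
    noncomm_ring⟩
  have hη : W.1 * η.1 = ξ.1 * W.1 := by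
    simp only [η, ← mul_assoc, self_mul_transpose_SOn, one_mul]
  have hQ : symmPairing Q Y.left = (1 / 2) * trace ((ξ.1 * P.1 - P.1 * ξ.1) * Y.left.1) := rfl
  have hQv : Q.1 = ξ.1 * P.1 - P.1 * ξ.1 := rfl
  have h := hY (η, Q)
  have e1 := trace_mul_symm_mul_skew P Y.left ξ
  -- The `Symm(n)`-component of `dTarget` vanishes along this vector. Paired with `y'` this is the
  -- trace identity for the symmetric matrices `P` and `W y' Wᵀ` and the skew-symmetric `ξ`.
  have e2 := trace_mul_symm_mul_skew P (Φ W Y'.left) ξ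
  rw [trace_mul_comm, ← mul_assoc] at e1 e2
  have hΦ : (Φ W Y'.left).1 = W.1 * Y'.left.1 * (W.1)ᵀ := rfl
  have e3 : ∀ A, trace (A * (Φ W Y'.left).1) = trace ((W.1)ᵀ * A * W.1 * Y'.left.1) := fun A => by
    rw [hΦ, ← mul_assoc, trace_mul_comm]
    simp only [mul_assoc]
  rw [e3, e3] at e2
  simp only [dTarget, dSource, LinearMap.coe_mk, AddHom.coe_mk, pairing_mk, soPairing_skew,
    symmPairing_sym, hη, hQ, hQv] at h
  simp only [sub_mul, mul_sub, add_mul, mul_add, smul_mul_assoc, trace_sub,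
    trace_add, trace_smul, smul_eq_mul, mul_assoc] at h e1 e2 ⊢
  linear_combination h + e1 / 2 - e2 / 2

/-- The bracket at the source has the same expression as the one at the target in
`pairing_target_lie`. -/
theorem pairing_source_lie {ε : ℝ} {J : Symm n} {W : SOn n} {P : Symm n} {X X' Y Y' : SemiProd n}
    (hX : ∀ u, pairing (dTarget ε J W P u) X' = pairing (dSource ε J W P u) X)
    (hY : ∀ u, pairing (dTarget ε J W P u) Y' = pairing (dSource ε J W P u) Y) :
    pairing (source ε J W P) ⁅X, Y⁆ =
      (1 / ε) * trace (J.1 * X.right.1 * W.1 * Y'.right.1) -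
        (ε / 2) * trace (J.1 * X.right.1 * P.1 * W.1 * Y'.right.1) -
      ((1 / ε) * trace (J.1 * Y.right.1 * W.1 * X'.right.1) -
        (ε / 2) * trace (J.1 * Y.right.1 * P.1 * W.1 * X'.right.1)) := by
  have hlie : (⁅X.right, Y.right⁆ : son n).1 =
    X.right.1 * Y.right.1 - Y.right.1 * X.right.1 := rfl
  have cyc : ∀ A B : Matrix (Fin n) (Fin n) ℝ, trace (A * B) = trace (B * A) := trace_mul_comm
  rw [pairing_lie]
  simp only [source, momBefore_eq_skew, soPairing_skew, hlie]
  rw [trace_mul_left_of_conormal hY, trace_mul_left_of_conormal hX]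
  simp only [sub_mul, mul_sub, smul_mul_assoc, trace_sub, trace_smul, smul_eq_mul, mul_assoc]
  rw [cyc X.right.1 (W.1 * _), cyc Y.right.1 (W.1 * _), cyc X.right.1 (P.1 * _),
    cyc Y.right.1 (P.1 * _)]
  simp only [mul_assoc]
  ring

theorem pairing_target_lie_eq_source {ε : ℝ} {J : Symm n} {W : SOn n} {P : Symm n}
    {X X' Y Y' : SemiProd n}
    (hX : ∀ u, pairing (dTarget ε J W P u) X' = pairing (dSource ε J W P u) X)
    (hY : ∀ u, pairing (dTarget ε J W P u) Y' = pairing (dSource ε J W P u) Y) :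
    pairing (target ε J W P) ⁅X', Y'⁆ = pairing (source ε J W P) ⁅X, Y⁆ := by
  rw [pairing_source_lie hX hY, pairing_target_lie hX hY]

/-! ### The correspondence -/

theorem hasDerivAt_add_smul {E : Type*} [NormedAddCommGroup E] [NormedSpace ℝ E] (x v : E) :
    HasDerivAt (fun s : ℝ => x + s • v) v 0 := by
  have h := ((hasDerivAt_id (0 : ℝ)).smul_const v).const_add x
  rw [one_smul] at h
  exact h

theorem pairing_gradient_of_hasZeroDifferential {ε : ℝ} {J : Symm n} {W : SOn n} {P : Symm n}
    {F F' : Phase n → ℝ} (hF : ContDiff ℝ ∞ F) (hF' : ContDiff ℝ ∞ F')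
    (h : HasZeroDifferential (fun w p => F' (target ε J w p) - F (source ε J w p)) W P)
    (u : Phase n) :
    pairing (dTarget ε J W P u) (gradient F' (target ε J W P)) =
      pairing (dSource ε J W P u) (gradient F (source ε J W P)) := by
  obtain ⟨η, Q⟩ := u
  have hw := hasDerivAt_mul_expSO W η
  have hp := hasDerivAt_add_smul P Q
  have hp0 : P + (0 : ℝ) • Q = P := by simp
  have hs := hasDerivAt_source ε J hw hp (mul_expSO_zero W η) hp0
  have ht := hasDerivAt_target ε J hw hp (mul_expSO_zero W η) hp0
  have hF1 : HasFDerivAt F (fderiv ℝ F (source ε J W P))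
      (source ε J (W * expSO ((0 : ℝ) • η)) (P + (0 : ℝ) • Q)) := by
    rw [mul_expSO_zero, hp0]
    exact (hF.differentiable (by simp) _).hasFDerivAt
  have hF1' : HasFDerivAt F' (fderiv ℝ F' (target ε J W P))
      (target ε J (W * expSO ((0 : ℝ) • η)) (P + (0 : ℝ) • Q)) := by
    rw [mul_expSO_zero, hp0]
    exact (hF'.differentiable (by simp) _).hasFDerivAt
  have h1 := ((hF1'.comp_hasDerivAt (0 : ℝ) ht).sub (hF1.comp_hasDerivAt (0 : ℝ) hs)).unique (h η Q)
  rw [pairing_gradient, pairing_gradient]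
  exact sub_eq_zero.1 h1

theorem isPoissonCorrespondence_source_target (ε : ℝ) (J : Symm n) :
    IsPoissonCorrespondence (source ε J) (target ε J) := by
  intro W P F F' G G' hF hF' hG hG' h1 h2
  exact pairing_target_lie_eq_source (pairing_gradient_of_hasZeroDifferential hF hF' h1)
    (pairing_gradient_of_hasZeroDifferential hG hG' h2)

/-! ### Single-valued branches -/

theorem transpose_mul_deriv_mem_son {w : ℝ → SOn n} {D : Matrix (Fin n) (Fin n) ℝ} {t : ℝ}
    (hw : HasDerivAt (fun s => (w s).1) D t) : ((w t).1)ᵀ * D ∈ son n := by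
  have h1 := hasDerivAt_matrix_mul (hasDerivAt_matrix_transpose hw) hw
  simp only [transpose_mul_self_SOn] at h1
  have h2 := h1.unique (hasDerivAt_const t (1 : Matrix (Fin n) (Fin n) ℝ))
  rw [mem_son, transpose_mul, transpose_transpose]
  exact eq_neg_of_add_eq_zero_left h2

section Branch

variable {ε : ℝ} {J : Symm n} {U : Set (Phase n)} {W : Phase n → SOn n} {Ψ : Phase n → Phase n}

theorem differentiableAt_Symm_coe {E : Type*} [NormedAddCommGroup E] [NormedSpace ℝ E]
    {f : E → Symm n} {x : E} (hf : DifferentiableAt ℝ f x) :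
    DifferentiableAt ℝ (fun y => (f y).1) x :=
  differentiableAt_linearMap (Symm n).subtype hf

theorem differentiableAt_branch {x : Phase n}
    (hW : DifferentiableAt ℝ (fun x => (W x).1) x) :
    DifferentiableAt ℝ (fun x => target ε J (W x) x.2) x := by
  have hP : DifferentiableAt ℝ (fun x : Phase n => x.2.1) x :=
    differentiableAt_Symm_coe differentiableAt_snd
  have hJ := differentiableAt_const (𝕜 := ℝ) (x := x) J.1
  have hWt : DifferentiableAt ℝ (fun x => ((W x).1)ᵀ) x :=
    differentiableAt_linearMap (transposeLinearEquiv (Fin n) (Fin n) ℝ ℝ).toLinearMap hW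
  have h1 := differentiableAt_matrix_mul hJ hW
  have h2 := differentiableAt_matrix_mul (differentiableAt_matrix_mul hJ hP) hW
  have h3 := differentiableAt_linearMap skew ((h1.const_smul (1 / ε)).sub (h2.const_smul (ε / 2)))
  have h4 := differentiableAt_linearMap sym
    (differentiableAt_matrix_mul (differentiableAt_matrix_mul hWt hP) hW)
  exact (h3.prodMk h4).congr_of_eventuallyEq
    (.of_forall fun y => Prod.ext (momAfter_eq_skew ..) (Φ_inv_eq_sym ..))

theorem IsStep.eq_source {W : SOn n} {x x' : Phase n} (h : IsStep ε J W x x') :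
    source ε J W x.2 = x := Prod.ext h.1.symm rfl

theorem IsStep.eq_target {W : SOn n} {x x' : Phase n} (h : IsStep ε J W x x') :
    x' = target ε J W x.2 := Prod.ext h.2.1 h.2.2

theorem differentiableAt_of_isStep (hU : IsOpen U)
    (hW : DifferentiableOn ℝ (fun x => (W x).1) U) (h : ∀ x ∈ U, IsStep ε J (W x) x (Ψ x))
    {x : Phase n} (hx : x ∈ U) : DifferentiableAt ℝ Ψ x :=
  (differentiableAt_branch (hW.differentiableAt (hU.mem_nhds hx))).congr_of_eventuallyEq <|
    Filter.eventuallyEq_of_mem (hU.mem_nhds hx) fun y hy => (h y hy).eq_target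

/-- The witness `u` is the velocity at `x = (M, P)`, in the direction `v`, of the section
`x ↦ (W(x), P)` of the source map. -/
theorem exists_dSource_eq (hU : IsOpen U)
    (hW : DifferentiableOn ℝ (fun x => (W x).1) U) (h : ∀ x ∈ U, IsStep ε J (W x) x (Ψ x))
    {x : Phase n} (hx : x ∈ U) (v : Phase n) :
    ∃ u, dSource ε J (W x) x.2 u = v ∧ dTarget ε J (W x) x.2 u = fderiv ℝ Ψ x v := by
  have hline := hasDerivAt_add_smul x v
  have hx0 : x + (0 : ℝ) • v = x := by simp
  have hUs : ∀ᶠ s : ℝ in nhds 0, x + s • v ∈ U :=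
    hline.continuousAt.eventually_mem (by rw [hx0]; exact hU.mem_nhds hx)
  have hw : HasDerivAt (fun s : ℝ => (W (x + s • v)).1) (fderiv ℝ (fun x => (W x).1) x v) 0 := by
    have hd : HasFDerivAt (fun x => (W x).1) (fderiv ℝ (fun x => (W x).1) x)
        (x + (0 : ℝ) • v) := by
      rw [hx0]; exact (hW.differentiableAt (hU.mem_nhds hx)).hasFDerivAt
    exact hd.comp_hasDerivAt (0 : ℝ) hline
  have hskew := transpose_mul_deriv_mem_son hw
  rw [hx0] at hskew
  let η : son n := ⟨_, hskew⟩
  have hη : (W x).1 * η.1 = fderiv ℝ (fun x => (W x).1) x v := by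
    rw [← mul_assoc, self_mul_transpose_SOn, one_mul]
  rw [← hη] at hw
  have hp : HasDerivAt (fun s : ℝ => (x + s • v).2) v.2 0 := by
    exact (hasFDerivAt_snd (𝕜 := ℝ)).comp_hasDerivAt (0 : ℝ) hline
  have hs := hasDerivAt_source ε J hw hp (by rw [hx0]) (by rw [hx0])
  have ht := hasDerivAt_target ε J hw hp (by rw [hx0]) (by rw [hx0])
  refine ⟨(η, v.2), ?_, ?_⟩
  · refine hs.unique (hline.congr_of_eventuallyEq ?_)
    filter_upwards [hUs] with s hs using (h _ hs).eq_source
  · have hd : HasFDerivAt Ψ (fderiv ℝ Ψ x) (x + (0 : ℝ) • v) := by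
      rw [hx0]; exact (differentiableAt_of_isStep hU hW h hx).hasFDerivAt
    refine ht.unique ((hd.comp_hasDerivAt (0 : ℝ) hline).congr_of_eventuallyEq ?_)
    filter_upwards [hUs] with s hs using (h _ hs).eq_target.symm

theorem dTarget_eq_fderiv (hU : IsOpen U)
    (hW : DifferentiableOn ℝ (fun x => (W x).1) U) (h : ∀ x ∈ U, IsStep ε J (W x) x (Ψ x))
    {x : Phase n} (hx : x ∈ U) (u : Phase n) :
    dTarget ε J (W x) x.2 u = fderiv ℝ Ψ x (dSource ε J (W x) x.2 u) := by
  have hsurj : Function.Surjective (dSource ε J (W x) x.2) := fun v =>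
    (exists_dSource_eq hU hW h hx v).imp fun _ h => h.1
  have hinj := LinearMap.injective_iff_surjective.2 hsurj
  obtain ⟨u', h1, h2⟩ := exists_dSource_eq hU hW h hx (dSource ε J (W x) x.2 u)
  rw [← h2, hinj h1]

theorem isPoissonMapOn_of_isStep (hU : IsOpen U)
    (hW : DifferentiableOn ℝ (fun x => (W x).1) U) (h : ∀ x ∈ U, IsStep ε J (W x) x (Ψ x)) :
    IsPoissonMapOn Ψ U := by
  refine ⟨fun x hx => (differentiableAt_of_isStep hU hW h hx).differentiableWithinAt,
    fun F G hF hG x hx => ?_⟩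
  have key : ∀ F : Phase n → ℝ, ContDiff ℝ ∞ F → ∀ u,
      pairing (dTarget ε J (W x) x.2 u) (gradient F (Ψ x)) =
        pairing (dSource ε J (W x) x.2 u) (gradient (F ∘ Ψ) x) := by
    intro F hF u
    rw [pairing_gradient, pairing_gradient, dTarget_eq_fderiv hU hW h hx]
    have hc := fderiv_comp x (hF.differentiable (by simp) (Ψ x))
      (differentiableAt_of_isStep hU hW h hx)
    exact (DFunLike.congr_fun hc (dSource ε J (W x) x.2 u)).symm
  have := pairing_target_lie_eq_source (key F hF) (key G hG)
  rw [(h x hx).eq_source, ← (h x hx).eq_target] at this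
  exact this.symm

end Branch

end DiscreteTop

open DiscreteTop
theorem theorem3 (n : ℕ) (ε : ℝ) (hε : ε ≠ 0) (J : Symm n) :
    -- the discrete Euler-Lagrange equations are equivalent to the explicit system
    (∀ (A : Symm n) (k₀ k₁ : ℤ), k₀ < k₁ →
      (∀ g : ℤ → SOn n, ∃ M : ℤ → son n, IsMomentumSeq (lagr ε J A) k₀ k₁ g M) ∧
      (∀ (g : ℤ → SOn n) (M : ℤ → son n),
        (IsMomentumSeq (lagr ε J A) k₀ k₁ g M ∧
          ∀ k ∈ Ioo k₀ k₁, DiscreteEL (lagr ε J A) (g (k - 1)) (g k) (g (k + 1))) ↔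
        ∀ k ∈ Ico k₀ k₁, IsStep ε J ((g k)⁻¹ * g (k + 1))
          (M k, Φ (g k)⁻¹ A) (M (k + 1), Φ (g (k + 1))⁻¹ A)) ∧
      (∀ (M : ℤ → son n) (P : ℤ → Symm n) (W : ℤ → SOn n),
        (∀ k ∈ Ico k₀ k₁, IsStep ε J (W k) (M k, P k) (M (k + 1), P (k + 1))) →
        ∀ g₀ : SOn n, P k₀ = Φ g₀⁻¹ A →
          ∃ g : ℤ → SOn n, g k₀ = g₀ ∧
            (∀ k ∈ Icc k₀ k₁, P k = Φ (g k)⁻¹ A) ∧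
            (∀ k ∈ Ico k₀ k₁, W k = (g k)⁻¹ * g (k + 1)) ∧
            IsMomentumSeq (lagr ε J A) k₀ k₁ g M ∧
            ∀ k ∈ Ioo k₀ k₁, DiscreteEL (lagr ε J A) (g (k - 1)) (g k) (g (k + 1)))) ∧
    -- the multivalued map is Poisson: as a correspondence ...
    IsPoissonCorrespondence (source ε J) (target ε J) ∧
    -- ... and on every local single-valued branch
    (∀ (U : Set (Phase n)) (W : Phase n → SOn n) (Ψ : Phase n → Phase n), IsOpen U →
      DifferentiableOn ℝ (fun x => ((W x : SOn n) : Matrix (Fin n) (Fin n) ℝ)) U →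
      (∀ x ∈ U, IsStep ε J (W x) x (Ψ x)) → IsPoissonMapOn Ψ U) :=
  ⟨fun A _ _ hk => ⟨exists_momentumSeq ε J A _ _,
    discreteEL_and_momenta_iff_isStep ε J A hk, exists_solution_of_isStep ε J A hk⟩,
   isPoissonCorrespondence_source_target ε J,
   fun _ _ _ hU hW h => isPoissonMapOn_of_isStep hU hW h⟩
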